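/- Let $K$ be a field of characteristic $0$, let $n\ge 1$, let $x_1,\dots,x_n$ be indeterminates over $K$, and write $\overline{x}_i=x_i^{-1}$. Let $c=(c_m)_{m\in\mathbb{Z}}$ be a doubly infinite sequence of elements of $K$, with shifts $(\tau^r c)_m=c_{m+r}$ for $r\in\mathbb{Z}$, and for a sequence $a=(a_m)_{m\in\mathbb Z}$ put $(y\,|\,a)^k=(y-a_0)(y-a_1)\cdots(y-a_{k-1})$ for $k\ge 0$. For a partition $\lambda=(\lambda_1\ge\dots\ge\lambda_n\ge 0)$ define the factorial even orthogonal character $$ \mathrm{o}_\lambda(x\,|\,c)=\frac{\eta\,\det\left[(x_i\,|\,c)^{\lambda_j+n-j}+(\overline{x}_i\,|\,c)^{\lambda_j+n-j}\right]_{i,j=1}^n}{\frac12\det\left[(x_i\,|\,c)^{n-j}+(\overline{x}_i\,|\,c)^{n-j}\right]_{i,j=1}^n},\qquad \eta=\begin{cases}\frac12,&\lambda_n=0,\\ 1,&\lambda_n>0.\end{cases} $$ For variables $y=(y_1,\dots,y_m)$ and a sequence $a$, the complete factorial symmetric polynomials are $$ h_k(y\,|\,a)=\frac{\det\left[(y_i\,|\,a)^{\mu_j+m-j}\right]_{i,j=1}^m}{\det\left[(y_i\,|\,a)^{m-j}\right]_{i,j=1}^m},\quad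 \mu=(k,0,\dots,0),\ k\ge 0, $$ and $h_k(y\,|\,a)=0$ for $k<0$; let $h_k(x,\overline{x}\,|\,a)$ denote $h_k$ in the $2n$ variables $x_1,\dots,x_n,\overline{x}_1,\dots,\overline{x}_n$. Theorem. Assume that $c_m=0$ for all $m<0$ and also $c_0=0$. Then for every partition $\lambda=(\lambda_1\ge\dots\ge\lambda_n\ge 0)$ the following identity holds in $K(x_1,\dots,x_n)$: $$ \mathrm{o}_\lambda(x\,|\,c)=\det\left[h_{\lambda_i-i+j}(x,\overline{x}\,|\,\tau^{1-n-j}c)-h_{\lambda_i-i-j}(x,\overline{x}\,|\,\tau^{1-n+j}c)\right]_{i,j=1}^n . $$ -/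

import Mathlib

noncomputable section

/-- The shift operator on doubly infinite sequences: `(τ^r c)_m = c_{m + r}`. -/
def seqShift {L : Type*} (r : ℤ) (c : ℤ → L) : ℤ → L := fun m => c (m + r)

/-- The factorial power `(x | c)^k = (x - c_0) ⋯ (x - c_{k-1})`, for `k ≥ 0`. -/
def factorialPow {L : Type*} [Field L] (x : L) (c : ℤ → L) (k : ℕ) : L :=
  ∏ l ∈ Finset.range k, (x - c (l : ℤ))

/-- The factorial Schur function `s_λ(y | c)` in `m` variables, as a ratio of alternants.
The column index `j : Fin m` counts from zero, so `m - j` with `j` counted from one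
is `m - 1 - j` here (and never truncates). -/
def factorialSchur {L : Type*} [Field L] {m : ℕ} (y : Fin m → L) (c : ℤ → L)
    (lam : Fin m → ℕ) : L :=
  (Matrix.of fun i j : Fin m => factorialPow (y i) c (lam j + (m - 1 - (j : ℕ)))).det /
    (Matrix.of fun i j : Fin m => factorialPow (y i) c (m - 1 - (j : ℕ))).det

/-- The complete factorial symmetric function `h_k(y | c)` for `k : ℤ`: it is
`s_{(k, 0, …, 0)}(y | c)` for `k ≥ 0` and zero for `k < 0`. -/
def factorialComplete {L : Type*} [Field L] {m : ℕ} (y : Fin m → L) (c : ℤ → L) (k : ℤ) : L :=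
  if k < 0 then 0
  else factorialSchur y c (fun i : Fin m => if (i : ℕ) = 0 then k.toNat else 0)

/-- The factorial even orthogonal character `o_λ(x | c)`, `n ≥ 1`, with the factor
`η = 1/2` if the last part `λ_n` vanishes and `η = 1` otherwise. -/
def factorialEvenOrthogonal {L : Type*} [Field L] {n : ℕ} (hn : 0 < n) (x : Fin n → L)
    (c : ℤ → L) (lam : Fin n → ℕ) : L :=
  ((if lam ⟨n - 1, Nat.sub_one_lt_of_lt hn⟩ = 0 then (1 / 2 : L) else 1) *
      (Matrix.of fun i j : Fin n =>
        factorialPow (x i) c (lam j + (n - 1 - (j : ℕ))) +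
          factorialPow (x i)⁻¹ c (lam j + (n - 1 - (j : ℕ)))).det) /
    ((1 / 2 : L) *
      (Matrix.of fun i j : Fin n =>
        factorialPow (x i) c (n - 1 - (j : ℕ)) +
          factorialPow (x i)⁻¹ c (n - 1 - (j : ℕ))).det)

/-- The field `K(x_1, …, x_n)` of rational functions in `n` indeterminates. -/
abbrev RatFun (K : Type*) [Field K] (n : ℕ) : Type _ := FractionRing (MvPolynomial (Fin n) K)

/-- The indeterminates `x_1, …, x_n`, as elements of `K(x_1, …, x_n)`. -/
def indet (K : Type*) [Field K] (n : ℕ) : Fin n → RatFun K n :=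
  fun i => algebraMap (MvPolynomial (Fin n) K) (RatFun K n) (MvPolynomial.X i)

/-- A sequence of scalars of `K`, seen in `K(x_1, …, x_n)`. -/
def constSeq {K : Type*} [Field K] (n : ℕ) (c : ℤ → K) : ℤ → RatFun K n :=
  fun m => algebraMap K (RatFun K n) (c m)

/-- The `2n` variables `x_1, …, x_n, x_1⁻¹, …, x_n⁻¹`. -/
def withInverses {L : Type*} [Field L] {n : ℕ} (x : Fin n → L) : Fin (n + n) → L :=
  Fin.append x (fun i => (x i)⁻¹)

end

open Finset Polynomial

/-! Since `h_k(y | a)` is the divided difference at the nodes `y` of the factorial power of degree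
`k + m - 1`, each matrix entry is a sum over the nodes `x_p`, `x_p⁻¹`. The weights there are `w_p
x_p^{-(n-1)}` and `-w_p x_p^{n-1}`. The vanishing of `c` at indices `≤ 0` turns the shifted
factorial powers into a power of `t` times `f_i(t) = (t | c)^{λ_i + n - i}`. The two terms of entry
`(i, j)` then combine to `∑_p w_p (x_p^j - x_p^{-j}) (f_i(x_p) + f_i(x_p⁻¹))`, halved when `f_i =
1`, which is the source of `η` (`evenOrthogonalEntry_eq`). So the determinant is `η` times the
numerator alternant times a determinant free of `λ`. At `λ = 0` the matrix is unitriangular, which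
identifies that last determinant as the inverse of the denominator of the character. -/

/-- The divided difference of `f` at the nodes `y`, as a sum over the nodes. -/
def dividedDifference {L : Type*} [Field L] {m : ℕ} (y : Fin m → L) (f : L → L) : L :=
  ∑ i, f (y i) / ∏ j ∈ univ.erase i, (y i - y j)

/-- The factorial power `(x | c)^k` as a polynomial in `x`. -/
noncomputable def factorialPowPoly {L : Type*} [Field L] (c : ℤ → L) (k : ℕ) : L[X] :=
  ∏ l ∈ range k, (X - C (c (l : ℤ)))

/-! ### Complete factorial polynomials as divided differences. -/

section Field

variable {L : Type*} [Field L]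

theorem eval_factorialPowPoly (x : L) (c : ℤ → L) (k : ℕ) :
    (factorialPowPoly c k).eval x = factorialPow x c k := by
  simp [factorialPowPoly, factorialPow, eval_prod]

theorem monic_factorialPowPoly (c : ℤ → L) (k : ℕ) : (factorialPowPoly c k).Monic :=
  monic_prod_of_monic _ _ fun _ _ => monic_X_sub_C _

theorem natDegree_factorialPowPoly (c : ℤ → L) (k : ℕ) : (factorialPowPoly c k).natDegree = k := by
  rw [factorialPowPoly, natDegree_prod_of_monic _ _ fun _ _ => monic_X_sub_C _]
  simp

theorem degree_factorialPowPoly (c : ℤ → L) (k : ℕ) : (factorialPowPoly c k).degree = k := by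
  rw [degree_eq_natDegree (monic_factorialPowPoly c k).ne_zero, natDegree_factorialPowPoly]

/-- By Lagrange interpolation, the divided difference of a polynomial of degree below `m` is its
coefficient of degree `m - 1`. -/
theorem dividedDifference_factorialPow {m : ℕ} {y : Fin m → L} (hy : Function.Injective y)
    (c : ℤ → L) {k : ℕ} (hk : k < m) :
    dividedDifference y (fun t => factorialPow t c k) = if k + 1 = m then 1 else 0 := by
  have h := Lagrange.coeff_eq_sum (s := univ) (v := y) hy.injOn (P := factorialPowPoly c k)
    (by rw [degree_factorialPowPoly]; simpa using hk)
  simp only [eval_factorialPowPoly, card_univ, Fintype.card_fin] at h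
  rw [dividedDifference, ← h]
  split_ifs with hm
  · subst hm
    simpa [natDegree_factorialPowPoly] using (monic_factorialPowPoly c k).coeff_natDegree
  · exact coeff_eq_zero_of_natDegree_lt (by rw [natDegree_factorialPowPoly]; omega)

theorem det_factorialPow_ne_zero {m : ℕ} {y : Fin m → L} (hy : Function.Injective y)
    (c : ℤ → L) :
    (Matrix.of fun i j : Fin m => factorialPow (y i) c (m - 1 - (j : ℕ))).det ≠ 0 := by
  have h := Matrix.det_eval_matrixOfPolynomials_eq_det_vandermonde y
    (fun j => factorialPowPoly c j) (fun _ => natDegree_factorialPowPoly c _)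
    (fun _ => monic_factorialPowPoly c _)
  have hne := Matrix.det_vandermonde_ne_zero_iff.2 hy
  rw [h] at hne
  have hrev : (Matrix.of fun i j : Fin m => factorialPow (y i) c (m - 1 - (j : ℕ))) =
      (Matrix.of fun i j : Fin m => (factorialPowPoly c (j : ℕ)).eval (y i)).submatrix id
        Fin.revPerm := by
    ext i j
    simp only [Matrix.of_apply, Matrix.submatrix_apply, eval_factorialPowPoly, id,
      Fin.revPerm_apply, Fin.val_rev]
    congr 1
    omega
  rw [hrev, Matrix.det_permute']
  refine mul_ne_zero ?_ hne
  rcases Int.units_eq_one_or (Equiv.Perm.sign (Fin.revPerm (n := m))) with h | h <;> simp [h]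

/-- A complete factorial symmetric polynomial is a divided difference of a factorial power. -/
theorem factorialSchur_row_eq_dividedDifference {m : ℕ} (hm : 0 < m) {y : Fin m → L}
    (hy : Function.Injective y) (c : ℤ → L) (k : ℕ) :
    factorialSchur y c (fun i : Fin m => if (i : ℕ) = 0 then k else 0) =
      dividedDifference y (fun t => factorialPow t c (k + (m - 1))) := by
  set A : Matrix (Fin m) (Fin m) L :=
    Matrix.of fun i j : Fin m => factorialPow (y i) c (m - 1 - (j : ℕ)) with hA
  set b : Fin m → L := fun i => factorialPow (y i) c (k + (m - 1)) with hb
  set w : Fin m → L := fun i => (∏ j ∈ univ.erase i, (y i - y j))⁻¹ with hw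
  let z : Fin m := ⟨0, hm⟩
  have hwA : Matrix.vecMul w A = Pi.single z 1 := by
    ext j
    have h := dividedDifference_factorialPow hy c (k := m - 1 - (j : ℕ)) (by omega)
    have h2 : Matrix.vecMul w A j =
        dividedDifference y (fun t => factorialPow t c (m - 1 - (j : ℕ))) := by
      simp only [Matrix.vecMul, dotProduct, dividedDifference, hw, hA, Matrix.of_apply]
      exact sum_congr rfl fun i _ => by rw [div_eq_mul_inv, mul_comm]
    rw [h2, h, Pi.single_apply]
    congr 1
    simp only [z, Fin.ext_iff, eq_iff_iff]
    omega
  have hcr : A.updateCol z b = Matrix.of fun i j : Fin m =>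
      factorialPow (y i) c ((if (j : ℕ) = 0 then k else 0) + (m - 1 - (j : ℕ))) := by
    ext i j
    rw [Matrix.updateCol_apply]
    by_cases hj : (j : ℕ) = 0
    · simp [hb, z, Fin.ext_iff, hj]
    · simp [hA, z, Fin.ext_iff, hj]
  have hdot : dividedDifference y (fun t => factorialPow t c (k + (m - 1))) = w ⬝ᵥ b := by
    simp only [dividedDifference, dotProduct, hw, hb]
    exact sum_congr rfl fun i _ => by rw [div_eq_mul_inv, mul_comm]
  -- Cramer's rule `A * cramer A b = det A • b`, paired on the left with `w`: as `w` times `A` is a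
  -- unit vector, only the coordinate `z` of `cramer A b` survives.
  have key : (A.updateCol z b).det = A.det * (w ⬝ᵥ b) := by
    have h := congrArg (w ⬝ᵥ ·) (Matrix.mulVec_cramer A b)
    simp only [Matrix.dotProduct_mulVec, hwA, single_dotProduct, one_mul, dotProduct_smul,
      smul_eq_mul, Matrix.cramer_apply] at h
    exact h
  rw [factorialSchur, ← hcr, key, hdot, mul_div_cancel_left₀ _ (det_factorialPow_ne_zero hy c)]

/-- Covers the negative `k ≥ -(m - 1)` as well: there the power has degree below `m - 1`, so its
divided difference vanishes. -/
theorem factorialComplete_eq_dividedDifference {m : ℕ} (hm : 0 < m) {y : Fin m → L}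
    (hy : Function.Injective y) (c : ℤ → L) {k : ℤ} {N : ℕ} (hN : k + (m - 1) = N) :
    factorialComplete y c k = dividedDifference y (fun t => factorialPow t c N) := by
  unfold factorialComplete
  split_ifs with hk
  · rw [dividedDifference_factorialPow hy c (by omega), if_neg (by omega)]
  · lift k to ℕ using not_lt.1 hk
    rw [Int.toNat_natCast, factorialSchur_row_eq_dividedDifference hm hy]
    congr! 3
    omega

theorem factorialComplete_zero {m : ℕ} (hm : 0 < m) {y : Fin m → L}
    (hy : Function.Injective y) (c : ℤ → L) : factorialComplete y c 0 = 1 := by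
  rw [factorialComplete_eq_dividedDifference hm hy c (N := m - 1) (by omega),
    dividedDifference_factorialPow hy c (by omega), if_pos (by omega)]

theorem factorialComplete_of_neg {m : ℕ} (y : Fin m → L) (c : ℤ → L) {k : ℤ} (hk : k < 0) :
    factorialComplete y c k = 0 := if_pos hk

/-! ### Factorial powers of sequences with leading zeros. -/

theorem factorialPow_shift_add {c : ℤ → L} (hc : ∀ m < 0, c m = 0) (x : L) (r m : ℕ) :
    factorialPow x (seqShift (-(r : ℤ)) c) (r + m) = x ^ r * factorialPow x c m := by
  rw [factorialPow, prod_range_add, factorialPow]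
  congr 1
  · rw [prod_congr rfl (g := fun _ => x), prod_const, card_range]
    intro l hl
    rw [mem_range] at hl
    rw [seqShift, hc _ (by omega), sub_zero]
  · exact prod_congr rfl fun l _ => by rw [seqShift]; congr 2; push_cast; ring

/-- The first `r` shifted parameters have indices `1 - r, …, 0` and vanish. The extra factor `x`
plays the role of `x - c 0`, which completes the remaining product and avoids the exponent `r - 1`.
-/
theorem factorialPow_shift_one_sub_mul {c : ℤ → L} (hc : ∀ m ≤ 0, c m = 0) (x : L) (r m : ℕ) :
    factorialPow x (seqShift (1 - (r : ℤ)) c) (r + m) * x = x ^ r * factorialPow x c (m + 1) := by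
  rw [← factorialPow_shift_add (fun m hm => hc m hm.le), ← add_assoc, factorialPow, factorialPow,
    prod_range_succ']
  congr 1
  · exact prod_congr rfl fun l _ => by simp only [seqShift]; congr 2; push_cast; ring
  · rw [seqShift, hc _ (by simp), sub_zero]

/-! ### Divided differences at reciprocal nodes. -/

/-- The factor shared by the divided-difference weights of the nodes `x_p` and `x_p⁻¹`
among the nodes `x, x⁻¹`. -/
def reciprocalWeight {n : ℕ} (x : Fin n → L) (p : Fin n) : L :=
  ((x p - (x p)⁻¹) * ∏ q ∈ univ.erase p, ((x p + (x p)⁻¹) - (x q + (x q)⁻¹)))⁻¹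

/-- Pairing `x q` with `(x q)⁻¹` extracts one factor `x p` for each of the `n - 1` indices `q ≠ p`;
the unpaired factor is `x p - (x p)⁻¹`. -/
theorem prod_erase_withInverses_castAdd {n : ℕ} {x : Fin n → L} (hx : ∀ i, x i ≠ 0) (p : Fin n) :
    ∏ j ∈ univ.erase (Fin.castAdd n p),
        (withInverses x (Fin.castAdd n p) - withInverses x j) =
      x p ^ (n - 1) * (reciprocalWeight x p)⁻¹ := by
  have hfac : ∀ q, (x p - x q) * (x p - (x q)⁻¹) =
      x p * ((x p + (x p)⁻¹) - (x q + (x q)⁻¹)) := fun q => by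
    have := hx p
    have := hx q
    field_simp
    ring
  have h1 : ∏ j ∈ univ.erase (Fin.castAdd n p),
        (withInverses x (Fin.castAdd n p) - withInverses x j) =
      (∏ q ∈ univ.erase p, (x p - x q)) * ∏ q, (x p - (x q)⁻¹) := by
    rw [← filter_ne' univ (Fin.castAdd n p), prod_filter, Fin.prod_univ_add,
      ← filter_ne' univ p, prod_filter]
    congr 1
    · simp [withInverses, -Fin.natAdd_eq_addNat]
    · refine prod_congr rfl fun q _ => ?_
      have : Fin.natAdd n q ≠ Fin.castAdd n p := by
        simp only [ne_eq, Fin.ext_iff, Fin.val_natAdd, Fin.val_castAdd]; omega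
      rw [if_pos this]
      simp [withInverses, -Fin.natAdd_eq_addNat]
  rw [h1, ← mul_prod_erase univ _ (mem_univ p), mul_left_comm, ← prod_mul_distrib]
  simp only [hfac, prod_mul_distrib, prod_const, card_erase_of_mem (mem_univ p), card_univ,
    Fintype.card_fin, reciprocalWeight, inv_inv]
  ring

theorem prod_erase_withInverses_natAdd {n : ℕ} {x : Fin n → L} (hx : ∀ i, x i ≠ 0) (p : Fin n) :
    ∏ j ∈ univ.erase (Fin.natAdd n p),
        (withInverses x (Fin.natAdd n p) - withInverses x j) =
      -((x p)⁻¹ ^ (n - 1) * (reciprocalWeight x p)⁻¹) := by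
  have hfac : ∀ q, ((x p)⁻¹ - x q) * ((x p)⁻¹ - (x q)⁻¹) =
      (x p)⁻¹ * ((x p + (x p)⁻¹) - (x q + (x q)⁻¹)) := fun q => by
    have := hx p
    have := hx q
    field_simp
    ring
  have h1 : ∏ j ∈ univ.erase (Fin.natAdd n p),
        (withInverses x (Fin.natAdd n p) - withInverses x j) =
      (∏ q, ((x p)⁻¹ - x q)) * ∏ q ∈ univ.erase p, ((x p)⁻¹ - (x q)⁻¹) := by
    rw [← filter_ne' univ (Fin.natAdd n p), prod_filter, Fin.prod_univ_add,
      ← filter_ne' univ p, prod_filter]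
    congr 1
    · refine prod_congr rfl fun q _ => ?_
      have : Fin.castAdd n q ≠ Fin.natAdd n p := by
        simp only [ne_eq, Fin.ext_iff, Fin.val_natAdd, Fin.val_castAdd]; omega
      rw [if_pos this]
      simp [withInverses, -Fin.natAdd_eq_addNat]
    · simp [withInverses, -Fin.natAdd_eq_addNat]
  rw [h1, ← mul_prod_erase univ _ (mem_univ p), mul_assoc, ← prod_mul_distrib]
  simp only [hfac, prod_mul_distrib, prod_const, card_erase_of_mem (mem_univ p), card_univ,
    Fintype.card_fin, reciprocalWeight, inv_inv]
  ring

theorem dividedDifference_withInverses {n : ℕ} {x : Fin n → L} (hx : ∀ i, x i ≠ 0) (f : L → L) :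
    dividedDifference (withInverses x) f =
      ∑ p, reciprocalWeight x p *
        ((x p)⁻¹ ^ (n - 1) * f (x p) - x p ^ (n - 1) * f (x p)⁻¹) := by
  rw [dividedDifference, Fin.sum_univ_add, ← sum_add_distrib]
  refine sum_congr rfl fun p _ => ?_
  rw [prod_erase_withInverses_castAdd hx, prod_erase_withInverses_natAdd hx]
  simp only [withInverses, Fin.append_left, Fin.append_right, div_eq_mul_inv, mul_inv, inv_neg,
    inv_inv, inv_pow]
  ring

/-! ### Factorisation of the Jacobi–Trudi matrix. -/

/-- The entries of the Jacobi–Trudi matrix of even orthogonal type. -/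
def evenOrthogonalEntry {n : ℕ} (x : Fin n → L) (c : ℤ → L) (lam : Fin n → ℕ) (i j : Fin n) : L :=
  factorialComplete (withInverses x) (seqShift (1 - (n : ℤ) - ((j : ℤ) + 1)) c)
      ((lam i : ℤ) - ((i : ℤ) + 1) + ((j : ℤ) + 1)) -
    factorialComplete (withInverses x) (seqShift (1 - (n : ℤ) + ((j : ℤ) + 1)) c)
      ((lam i : ℤ) - ((i : ℤ) + 1) - ((j : ℤ) + 1))

/-- The numerator alternant of the factorial even orthogonal character. -/
def evenOrthogonalAlternant {n : ℕ} (x : Fin n → L) (c : ℤ → L) (lam : Fin n → ℕ) :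
    Matrix (Fin n) (Fin n) L :=
  Matrix.of fun i j : Fin n =>
    factorialPow (x i) c (lam j + (n - 1 - (j : ℕ))) +
      factorialPow (x i)⁻¹ c (lam j + (n - 1 - (j : ℕ)))

/-- The matrix linking the alternant to the Jacobi–Trudi matrix. -/
def evenOrthogonalCofactor {n : ℕ} (x : Fin n → L) : Matrix (Fin n) (Fin n) L :=
  Matrix.of fun p j : Fin n =>
    reciprocalWeight x p * (x p ^ ((j : ℕ) + 1) - (x p)⁻¹ ^ ((j : ℕ) + 1))

variable {n : ℕ} {x : Fin n → L} {c : ℤ → L} {lam : Fin n → ℕ}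

theorem factorialComplete_withInverses_shift_down (hn : 0 < n)
    (hinj : Function.Injective (withInverses x)) (hx : ∀ i, x i ≠ 0)
    (hc : ∀ m ≤ 0, c m = 0) (i j : Fin n) :
    factorialComplete (withInverses x) (seqShift (1 - (n : ℤ) - ((j : ℤ) + 1)) c)
        ((lam i : ℤ) - ((i : ℤ) + 1) + ((j : ℤ) + 1)) =
      ∑ p, reciprocalWeight x p *
        (x p ^ ((j : ℕ) + 1) * factorialPow (x p) c (lam i + (n - 1 - (i : ℕ))) -
          (x p)⁻¹ ^ ((j : ℕ) + 1) * factorialPow (x p)⁻¹ c (lam i + (n - 1 - (i : ℕ)))) := by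
  rw [factorialComplete_eq_dividedDifference (by omega) hinj _
    (N := (n + j) + (lam i + (n - 1 - i))) (by omega), dividedDifference_withInverses hx]
  have hshift : 1 - (n : ℤ) - ((j : ℤ) + 1) = -((n + j : ℕ) : ℤ) := by push_cast; ring
  have hpow : ∀ t : L, t ≠ 0 → t⁻¹ ^ (n - 1) * t ^ (n + (j : ℕ)) = t ^ ((j : ℕ) + 1) := by
    intro t ht
    rw [show n + (j : ℕ) = (n - 1) + (j + 1) by omega, pow_add, ← mul_assoc, ← mul_pow,
      inv_mul_cancel₀ ht, one_pow, one_mul]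
  refine sum_congr rfl fun p _ => ?_
  have h1 := hpow (x p) (hx p)
  have h2 := hpow (x p)⁻¹ (inv_ne_zero (hx p))
  rw [inv_inv] at h2
  rw [hshift, factorialPow_shift_add (fun m hm => hc m hm.le),
    factorialPow_shift_add (fun m hm => hc m hm.le), ← mul_assoc, ← mul_assoc, h1, h2]

theorem factorialComplete_withInverses_shift_up (hn : 0 < n)
    (hinj : Function.Injective (withInverses x)) (hx : ∀ i, x i ≠ 0)
    (hc : ∀ m ≤ 0, c m = 0) (i j : Fin n) (hi : 0 < lam i + (n - 1 - (i : ℕ))) :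
    factorialComplete (withInverses x) (seqShift (1 - (n : ℤ) + ((j : ℤ) + 1)) c)
        ((lam i : ℤ) - ((i : ℤ) + 1) - ((j : ℤ) + 1)) =
      ∑ p, reciprocalWeight x p *
        ((x p)⁻¹ ^ ((j : ℕ) + 1) * factorialPow (x p) c (lam i + (n - 1 - (i : ℕ))) -
          x p ^ ((j : ℕ) + 1) * factorialPow (x p)⁻¹ c (lam i + (n - 1 - (i : ℕ)))) := by
  -- Positivity of the exponent `M + 1` provides the factor `t - c 0 = t` that the shifted power
  -- lacks.
  obtain ⟨M, hM⟩ := Nat.exists_eq_add_of_lt hi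
  rw [zero_add] at hM
  rw [factorialComplete_eq_dividedDifference (by omega) hinj _
    (N := (n - 1 - j) + M) (by omega), dividedDifference_withInverses hx, hM]
  have hshift : 1 - (n : ℤ) + ((j : ℤ) + 1) = 1 - ((n - 1 - j : ℕ) : ℤ) := by omega
  have hpow : ∀ t : L, t ≠ 0 →
      t⁻¹ ^ (n - 1) * factorialPow t (seqShift (1 - ((n - 1 - j : ℕ) : ℤ)) c) ((n - 1 - j) + M) =
        t⁻¹ ^ ((j : ℕ) + 1) * factorialPow t c (M + 1) := by
    intro t ht
    have h := factorialPow_shift_one_sub_mul hc t (n - 1 - j) M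
    rw [← mul_left_inj' ht, mul_assoc, h, ← mul_assoc]
    obtain ⟨r, hr⟩ : ∃ r, n - 1 - (j : ℕ) = r := ⟨_, rfl⟩
    rw [hr, show n - 1 = j + r by omega, pow_add, pow_succ, mul_assoc (t⁻¹ ^ (j : ℕ)), ← mul_pow,
      inv_mul_cancel₀ ht]
    field_simp
    simp
  refine sum_congr rfl fun p _ => ?_
  have h2 := hpow (x p)⁻¹ (inv_ne_zero (hx p))
  rw [inv_inv] at h2
  rw [hshift, hpow (x p) (hx p), h2]

theorem evenOrthogonalEntry_eq (hn : 0 < n) (h2 : (2 : L) ≠ 0)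
    (hinj : Function.Injective (withInverses x)) (hx : ∀ i, x i ≠ 0)
    (hc : ∀ m ≤ 0, c m = 0) (i j : Fin n) :
    evenOrthogonalEntry x c lam i j =
      (if lam i + (n - 1 - (i : ℕ)) = 0 then 1 / 2 else 1) *
        ((evenOrthogonalAlternant x c lam).transpose * evenOrthogonalCofactor x) i j := by
  rw [evenOrthogonalEntry, factorialComplete_withInverses_shift_down hn hinj hx hc,
    Matrix.mul_apply, mul_sum]
  simp only [evenOrthogonalAlternant, evenOrthogonalCofactor, Matrix.transpose_apply,
    Matrix.of_apply]
  split_ifs with hi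
  -- Here the second term vanishes, and the alternant entry is `1 + 1`, whence the factor `1 / 2`.
  · rw [factorialComplete_of_neg _ _ (by omega), sub_zero, hi]
    refine sum_congr rfl fun p _ => ?_
    simp only [factorialPow, range_zero, prod_empty]
    field_simp
    ring
  · rw [factorialComplete_withInverses_shift_up hn hinj hx hc i j (Nat.pos_of_ne_zero hi),
      ← sum_sub_distrib]
    exact sum_congr rfl fun p _ => by ring

theorem det_evenOrthogonalEntry (hn : 0 < n) (h2 : (2 : L) ≠ 0)
    (hinj : Function.Injective (withInverses x)) (hx : ∀ i, x i ≠ 0)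
    (hc : ∀ m ≤ 0, c m = 0) :
    (Matrix.of (evenOrthogonalEntry x c lam)).det =
      (if lam ⟨n - 1, Nat.sub_one_lt_of_lt hn⟩ = 0 then 1 / 2 else 1) *
        ((evenOrthogonalAlternant x c lam).det * (evenOrthogonalCofactor x).det) := by
  have h : Matrix.of (evenOrthogonalEntry x c lam) = Matrix.of fun i j : Fin n =>
      (if lam i + (n - 1 - (i : ℕ)) = 0 then (1 / 2 : L) else 1) *
        ((evenOrthogonalAlternant x c lam).transpose * evenOrthogonalCofactor x) i j := by
    ext i j
    exact evenOrthogonalEntry_eq hn h2 hinj hx hc i j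
  -- The exponent can vanish only in the last row, so the row factors multiply to `η`.
  rw [h, Matrix.det_mul_column, Matrix.det_mul, Matrix.det_transpose,
    prod_eq_single (⟨n - 1, Nat.sub_one_lt_of_lt hn⟩ : Fin n)]
  · simp
  · intro i _ hi
    rw [if_neg]
    rw [ne_eq, Fin.ext_iff] at hi
    simp only at hi
    omega
  · simp

/-- Below the diagonal both indices are negative; on it the first is `0` and the second negative. -/
theorem det_evenOrthogonalEntry_zero (hn : 0 < n) (hinj : Function.Injective (withInverses x)) :
    (Matrix.of (evenOrthogonalEntry x c fun _ => 0)).det = 1 := by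
  rw [Matrix.det_of_isUpperTriangular]
  · refine prod_eq_one fun i _ => ?_
    rw [Matrix.of_apply, evenOrthogonalEntry, factorialComplete_of_neg _ _ (k := _ - _ - _)
      (by omega), sub_zero]
    simpa using factorialComplete_zero (by omega) hinj _
  · intro i j hij
    have hij : (j : ℕ) < i := hij
    rw [Matrix.of_apply, evenOrthogonalEntry, factorialComplete_of_neg _ _ (by omega),
      factorialComplete_of_neg _ _ (by omega), sub_zero]

/-- The Jacobi–Trudi identity for factorial even orthogonal characters, at any point of a field
where the `2n` variables `x, x⁻¹` are distinct. -/
theorem factorialEvenOrthogonal_eq_det (hn : 0 < n) (h2 : (2 : L) ≠ 0)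
    (hinj : Function.Injective (withInverses x)) (hx : ∀ i, x i ≠ 0)
    (hc : ∀ m ≤ 0, c m = 0) :
    factorialEvenOrthogonal hn x c lam = (Matrix.of (evenOrthogonalEntry x c lam)).det := by
  have h0 := det_evenOrthogonalEntry (lam := fun _ => 0) hn h2 hinj hx hc
  rw [det_evenOrthogonalEntry_zero hn hinj, if_pos rfl] at h0
  have hden : factorialEvenOrthogonal hn x c lam =
      ((if lam ⟨n - 1, Nat.sub_one_lt_of_lt hn⟩ = 0 then (1 / 2 : L) else 1) *
        (evenOrthogonalAlternant x c lam).det) /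
        ((1 / 2 : L) * (evenOrthogonalAlternant x c fun _ => 0).det) := by
    simp only [factorialEvenOrthogonal, evenOrthogonalAlternant, zero_add]
  rw [← mul_assoc] at h0
  rw [hden, det_evenOrthogonalEntry hn h2 hinj hx hc,
    div_eq_iff (left_ne_zero_of_mul_eq_one h0.symm)]
  linear_combination (if lam ⟨n - 1, Nat.sub_one_lt_of_lt hn⟩ = 0 then (1 / 2 : L) else 1) *
    (evenOrthogonalAlternant x c lam).det * h0

end Field

/-! ### Distinctness of the indeterminates and their inverses. -/

theorem indet_injective (K : Type*) [Field K] (n : ℕ) : Function.Injective (indet K n) :=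
  (IsFractionRing.injective (MvPolynomial (Fin n) K) (RatFun K n)).comp
    (MvPolynomial.X_injective)

theorem indet_ne_zero (K : Type*) [Field K] (n : ℕ) (i : Fin n) : indet K n i ≠ 0 :=
  (map_ne_zero_iff _ (IsFractionRing.injective (MvPolynomial (Fin n) K) (RatFun K n))).2
    (MvPolynomial.X_ne_zero i)

theorem indet_mul_indet_ne_one (K : Type*) [Field K] (n : ℕ) (i j : Fin n) :
    indet K n i * indet K n j ≠ 1 := by
  intro h
  rw [indet, indet, ← map_mul, ← map_one (algebraMap (MvPolynomial (Fin n) K) (RatFun K n))] at h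
  -- At the origin the polynomial identity `X i * X j = 1` becomes `0 = 1`.
  have h := congrArg (MvPolynomial.eval fun _ => (0 : K))
    (IsFractionRing.injective (MvPolynomial (Fin n) K) (RatFun K n) h)
  simp at h

theorem withInverses_indet_injective (K : Type*) [Field K] (n : ℕ) :
    Function.Injective (withInverses (indet K n)) := by
  rw [withInverses, Fin.append_injective_iff]
  refine ⟨indet_injective K n, inv_injective.comp (indet_injective K n), fun i j h => ?_⟩
  exact indet_mul_indet_ne_one K n i j (by rw [h, inv_mul_cancel₀ (indet_ne_zero K n j)])

theorem mainTheorem8 {K : Type*} [Field K] [CharZero K] (n : ℕ) (hn : 0 < n)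
    (c : ℤ → K) (hc : ∀ m : ℤ, m < 0 → c m = 0) (hc0 : c 0 = 0)
    (lam : Fin n → ℕ) (hlam : Antitone lam) :
    factorialEvenOrthogonal hn (indet K n) (constSeq n c) lam =
      (Matrix.of fun i j : Fin n =>
        factorialComplete (withInverses (indet K n))
            (seqShift (1 - (n : ℤ) - ((j : ℤ) + 1)) (constSeq n c))
            ((lam i : ℤ) - ((i : ℤ) + 1) + ((j : ℤ) + 1)) -
          factorialComplete (withInverses (indet K n))
            (seqShift (1 - (n : ℤ) + ((j : ℤ) + 1)) (constSeq n c))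
            ((lam i : ℤ) - ((i : ℤ) + 1) - ((j : ℤ) + 1))).det := by
  have h2 : (2 : RatFun K n) ≠ 0 := by
    rw [← map_ofNat (algebraMap K (RatFun K n)) 2]
    exact (_root_.map_ne_zero _).2 two_ne_zero
  refine factorialEvenOrthogonal_eq_det hn h2 (withInverses_indet_injective K n)
    (indet_ne_zero K n) fun m hm => ?_
  rcases hm.lt_or_eq with h | rfl
  · rw [constSeq, hc m h, map_zero]
  · rw [constSeq, hc0, map_zero]
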